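/- Let $T>0$, let $P$ and $Q$ be nonempty compact metric spaces, and let $f:[0,T]\times\mathbb{R}^n\times P\to\mathbb{R}^n$ and $g:[0,T]\times\mathbb{R}^n\times Q\to\mathbb{R}^n$ be continuous functions which are Lipschitz continuous in the phase variable $x$ on every bounded set, uniformly in the other variables (that is, for every $R$ there is $L$ such that $\|f(t,x,u)-f(t,x',u)\|\le L\|x-x'\|$ for all $t\in[0,T]$, $u\in P$ and $\|x\|,\|x'\|\le R$, and likewise for $g$), and which satisfy the sublinear growth condition $\|f(t,x,u)\|\le C(1+\|x\|)$, $\|g(t,x,v)\|\le C(1+\|x\|)$ for some constant $C$. For measurable controls $u:[0,T]\to P$, $v:[0,T]\to Q$ and $(t_0,x_0)\in[0,T]\times\mathbb{R}^n$, let $x(\cdot,t_0,x_0,u,v):[0,T]\to\mathbb{R}^n$ be the (Carathéodory) solution of $\dot x(t)=f(t,x(t),u(t))+g(t,x(t),v(t))$, $x(t_0)=x_0$, and let $\mathrm{Sol}(t_0,x_0)$ be the closure, in the space of continuous functions $[0,T]\to\mathbb{R}^n$ with the uniform norm, of the set of all $x(\cdot,t_0,x_0,u,v)$ with $u,v$ measurable.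 Let $c_1,c_2:[0,T]\times\mathbb{R}^n\to\mathbb{R}$ be continuous. Condition (F4) reads: for every $(t_*,x_*)\in[0,T]\times\mathbb{R}^n$ there is a motion $y\in\mathrm{Sol}(t_*,x_*)$ such that $c_i(t,y(t))=c_i(t_*,x_*)$ for all $t\in[t_*,T]$ and $i=1,2$. For $t\in[0,T)$ and $x,w\in\mathbb{R}^n$ define the convexified velocity set and the modulus derivative (with values in $[0,\infty]$) by $$\mathcal{F}(t,x):=\mathrm{co}\{f(t,x,u)+g(t,x,v):u\in P,\ v\in Q\},$$ $$\mathrm{d}_{abs}(c_1,c_2)(t,x;w):=\liminf_{\delta\downarrow0,\ w'\to w}\frac{|c_1(t+\delta,x+\delta w')-c_1(t,x)|+|c_2(t+\delta,x+\delta w')-c_2(t,x)|}{\delta}.$$ Then condition (F4) holds if and only if, for every $(t,x)\in[0,T)\times\mathbb{R}^n$, $$\inf_{w\in\mathcal{F}(t,x)}\mathrm{d}_{abs}(c_1,c_2)(t,x;w)=0.$$ -/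

import Mathlib

open Set Filter Topology MeasureTheory
open scoped ENNReal

noncomputable section

namespace DiffGame

/-- The phase space `ℝⁿ` with its Euclidean norm. -/
abbrev Phase (n : ℕ) : Type := EuclideanSpace ℝ (Fin n)

variable {n : ℕ} {P Q : Type*}

/-- `f` is continuous on `[0,T] × ℝⁿ × P`. -/
def ContinuousDynamics [TopologicalSpace P] (T : ℝ) (f : ℝ → Phase n → P → Phase n) : Prop :=
  ContinuousOn (fun p : ℝ × Phase n × P => f p.1 p.2.1 p.2.2) (Icc 0 T ×ˢ univ)

/-- `f` is Lipschitz continuous in the phase variable on bounded sets, uniformly in the time and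
the control.  (A globally Lipschitz `f` is a special case.) -/
def LipschitzInPhase (T : ℝ) (f : ℝ → Phase n → P → Phase n) : Prop :=
  ∀ R : ℝ, ∃ L : ℝ, ∀ t ∈ Icc 0 T, ∀ x x' : Phase n, ‖x‖ ≤ R → ‖x'‖ ≤ R → ∀ u : P,
    ‖f t x u - f t x' u‖ ≤ L * ‖x - x'‖

/-- The sublinear growth condition with respect to the phase variable. -/
def SublinearGrowth (T : ℝ) (f : ℝ → Phase n → P → Phase n) : Prop :=
  ∃ C : ℝ, ∀ t ∈ Icc 0 T, ∀ x : Phase n, ∀ u : P, ‖f t x u‖ ≤ C * (1 + ‖x‖)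

/-- `x` is on `[0,T]` the (Carathéodory) solution `x(·,t₀,x₀,u,v)` of
`x' = f(t,x,u(t)) + g(t,x,v(t))`, `x(t₀) = x₀`. -/
def IsSolution (T : ℝ) (f : ℝ → Phase n → P → Phase n) (g : ℝ → Phase n → Q → Phase n)
    (t₀ : ℝ) (x₀ : Phase n) (u : ℝ → P) (v : ℝ → Q) (x : ℝ → Phase n) : Prop :=
  ContinuousOn x (Icc 0 T) ∧
  IntervalIntegrable (fun s => f s (x s) (u s) + g s (x s) (v s)) volume 0 T ∧
  ∀ t ∈ Icc 0 T, x t = x₀ + ∫ s in t₀..t, (f s (x s) (u s) + g s (x s) (v s))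

/-- The set `Sol(t₀,x₀)`: the closure, in the space of continuous functions `[0,T] → ℝⁿ` with the
uniform norm, of the set of all solutions `x(·,t₀,x₀,u,v)` with measurable controls `u`, `v`.
A measurable control on `[0,T]` is written as a measurable function on `ℝ`; only its values on
`[0,T]` matter. -/
def Sol [MeasurableSpace P] [MeasurableSpace Q] (T : ℝ)
    (f : ℝ → Phase n → P → Phase n) (g : ℝ → Phase n → Q → Phase n)
    (t₀ : ℝ) (x₀ : Phase n) : Set C(Icc (0 : ℝ) T, Phase n) :=
  closure {y | ∃ (u : ℝ → P) (v : ℝ → Q), Measurable u ∧ Measurable v ∧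
    ∃ x : ℝ → Phase n, IsSolution T f g t₀ x₀ u v x ∧ ∀ s : Icc (0 : ℝ) T, y s = x s}

/-- Condition (F4): from every position there starts a motion along which both `c₁` and `c₂`
are constant. -/
def ConditionF4 [MeasurableSpace P] [MeasurableSpace Q] (T : ℝ)
    (f : ℝ → Phase n → P → Phase n) (g : ℝ → Phase n → Q → Phase n)
    (c₁ c₂ : ℝ → Phase n → ℝ) : Prop :=
  ∀ t₀ ∈ Icc 0 T, ∀ x₀ : Phase n, ∃ y ∈ Sol T f g t₀ x₀,
    ∀ t : Icc (0 : ℝ) T, t₀ ≤ t → c₁ t (y t) = c₁ t₀ x₀ ∧ c₂ t (y t) = c₂ t₀ x₀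

/-- The convexified velocity set `co {f(t,x,u) + g(t,x,v) : u ∈ P, v ∈ Q}`. -/
def velocitySet (f : ℝ → Phase n → P → Phase n) (g : ℝ → Phase n → Q → Phase n)
    (t : ℝ) (x : Phase n) : Set (Phase n) :=
  convexHull ℝ {w | ∃ (u : P) (v : Q), w = f t x u + g t x v}

/-- The modulus derivative of `(c₁,c₂)` at the position `(t,x)` in the direction `w`, with values
in `[0,∞]`: the lower limit, as `δ ↓ 0` and `w' → w`, of
`(|c₁(t+δ,x+δw') - c₁(t,x)| + |c₂(t+δ,x+δw') - c₂(t,x)|) / δ`. -/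
def modulusDeriv (c₁ c₂ : ℝ → Phase n → ℝ) (t : ℝ) (x w : Phase n) : ℝ≥0∞ :=
  liminf (fun p : ℝ × Phase n => ENNReal.ofReal
      ((|c₁ (t + p.1) (x + p.1 • p.2) - c₁ t x| + |c₂ (t + p.1) (x + p.1 • p.2) - c₂ t x|) / p.1))
    (𝓝[>] (0 : ℝ) ×ˢ 𝓝 w)

end DiffGame

end

/-! Both directions compare motions with the convexified velocity set, after the two players'
controls are merged into one control in `P × Q`.

From (F4) to the derivative condition: let `y` be a motion from `(t, x)` along which both functions
are constant. For controlled curves near `y`, the difference quotient over `[t, t + δ]` is an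
average of velocities close to those at `(t, x)`, so it lies in a small thickening of the convex
compact set of velocities there. This passes to uniform limits, hence the quotients of `y` cluster
at some `w` in that set (`exists_velocity_mapClusterPt`). Along the quotients the numerator of the
modulus derivative vanishes, so the derivative in the direction `w` is zero.

Conversely, fix `ε`. The condition gives at every position a direction in which the pair `(c₁, c₂)`
changes at a rate below `ε`, and fast switching of controls realizes this direction on average. Such
steps are concatenated (`exists_approxStep`, `exists_chain`) until the time exceeds `T - ε`; a
supremum argument shows that they cannot stall earlier. The control collected on the way drives a
genuine solution which, by Grönwall, stays within a multiple of `ε` of the polygonal data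
(`norm_sub_le_of_approx`). As `ε → 0`, Arzelà–Ascoli gives a uniform limit, and both functions are
constant along it (`exists_invariant_motion`). -/

namespace DiffGame

/-! ### Convex hulls of compact sets -/

/-- The convex hull of a compact set in a finite-dimensional space is compact. -/
theorem isCompact_convexHull {E : Type*} [NormedAddCommGroup E] [NormedSpace ℝ E]
    [FiniteDimensional ℝ E] {s : Set E} (hs : IsCompact s) : IsCompact (convexHull ℝ s) := by
  let Φ : (m : ℕ) → (Fin m → E) × (Fin m → ℝ) → E := fun m p => ∑ i, p.2 i • p.1 i
  let A : (m : ℕ) → Set E := fun m =>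
    Φ m '' ((Set.univ.pi fun _ => s) ×ˢ stdSimplex ℝ (Fin m))
  have hA : ∀ m, IsCompact (A m) := fun m =>
    ((isCompact_univ_pi fun _ => hs).prod (isCompact_stdSimplex ℝ (Fin m))).image (by fun_prop)
  -- Carathéodory: at most `finrank + 1` points are needed, so the hull is a finite union of
  -- continuous images of compact sets.
  have key : convexHull ℝ s = ⋃ m ∈ Finset.range (Module.finrank ℝ E + 2), A m := by
    apply Subset.antisymm
    · intro x hx
      obtain ⟨ι, _, z, w, hz, hind, hw, hsum, rfl⟩ := eq_pos_convex_span_of_mem_convexHull hx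
      have hcard := hind.card_le_finrank_succ
      have hle := Submodule.finrank_le (vectorSpan ℝ (range z))
      let e := Fintype.equivFin ι
      refine mem_iUnion₂.2 ⟨Fintype.card ι, Finset.mem_range.2 (by omega),
        (z ∘ e.symm, w ∘ e.symm), ⟨fun i _ => hz ⟨_, rfl⟩, fun i => (hw _).le, ?_⟩, ?_⟩
      · rw [← hsum]
        exact e.symm.sum_comp w
      · exact e.symm.sum_comp fun i => w i • z i
    · intro x hx
      obtain ⟨m, -, p, ⟨hp, hq⟩, rfl⟩ := mem_iUnion₂.1 hx
      exact (convex_convexHull ℝ s).sum_mem (fun i _ => hq.1 i) hq.2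
        fun i _ => subset_convexHull ℝ s (hp i (mem_univ i))
  rw [key]
  exact Finset.isCompact_biUnion _ fun m _ => hA m

/-! ### Realizing a convex combination by switching -/

/-- Every convex combination of the values of `φ` is the average of `φ ∘ κ` for a measurable
control `κ`. -/
theorem exists_integral_eq_of_mem_convexHull {E K : Type*} [NormedAddCommGroup E] [NormedSpace ℝ E]
    [CompleteSpace E]
    [MeasurableSpace K] {φ : K → E} {w : E} (hw : w ∈ convexHull ℝ (range φ)) :
    ∀ a b : ℝ, a ≤ b → ∃ κ : ℝ → K, Measurable κ ∧
      IntervalIntegrable (fun s => φ (κ s)) volume a b ∧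
        ∫ s in a..b, φ (κ s) = (b - a) • w := by
  -- Realizability is demanded on every interval at once. This makes the set convex: split `[a, b]`
  -- in the ratio `α : β` and use one control on each part.
  let S : Set E := {w | ∀ a b : ℝ, a ≤ b → ∃ κ : ℝ → K, Measurable κ ∧
      IntervalIntegrable (fun s => φ (κ s)) volume a b ∧ ∫ s in a..b, φ (κ s) = (b - a) • w}
  refine (convexHull_min (t := S) ?_ ?_) hw
  · rintro _ ⟨k, rfl⟩ a b _
    exact ⟨fun _ => k, measurable_const, intervalIntegrable_const, by simp⟩
  · intro w₁ h₁ w₂ h₂ α β hα hβ hαβ a b hab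
    set c := a + α * (b - a) with hc
    have hac : a ≤ c := by nlinarith
    have hcb : c ≤ b := by nlinarith
    obtain ⟨κ₁, m₁, i₁, e₁⟩ := h₁ a c hac
    obtain ⟨κ₂, m₂, i₂, e₂⟩ := h₂ c b hcb
    let κ : ℝ → K := (Iic c).piecewise κ₁ κ₂
    have k₁ : EqOn (fun s => φ (κ₁ s)) (fun s => φ (κ s)) (uIoc a c) := by
      intro s hs
      rw [uIoc_of_le hac] at hs
      simp [κ, hs.2]
    have k₂ : EqOn (fun s => φ (κ₂ s)) (fun s => φ (κ s)) (uIoc c b) := by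
      intro s hs
      rw [uIoc_of_le hcb] at hs
      simp [κ, not_le.2 hs.1]
    have j₁ := i₁.congr k₁
    have j₂ := i₂.congr k₂
    refine ⟨κ, m₁.piecewise measurableSet_Iic m₂, j₁.trans j₂, ?_⟩
    rw [← intervalIntegral.integral_add_adjacent_intervals j₁ j₂,
      ← intervalIntegral.integral_congr_ae (Eventually.of_forall fun s hs => k₁ hs),
      ← intervalIntegral.integral_congr_ae (Eventually.of_forall fun s hs => k₂ hs), e₁, e₂,
      smul_add, smul_smul, smul_smul]
    have hβ' : β = 1 - α := by linarith
    congr 2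
    · rw [hc]; ring
    · rw [hc, hβ']; ring

/-! ### An exponential integral -/

theorem abs_integral_exp_abs_sub (a t₀ t : ℝ) :
    |∫ s in t₀..t, a * Real.exp (a * |s - t₀|)| = |Real.exp (a * |t - t₀|) - 1| := by
  rcases le_total t₀ t with h | h
  · have : ∫ s in t₀..t, a * Real.exp (a * |s - t₀|) = ∫ s in t₀..t, a * Real.exp (a * (s - t₀)) := by
      refine intervalIntegral.integral_congr fun s hs => ?_
      rw [uIcc_of_le h] at hs
      simp only [abs_of_nonneg (sub_nonneg.2 hs.1)]
    rw [this, intervalIntegral.integral_eq_sub_of_hasDerivAt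
      (f := fun s => Real.exp (a * (s - t₀)))]
    · simp [abs_of_nonneg (sub_nonneg.2 h)]
    · intro s _
      simpa [mul_comm] using (((hasDerivAt_id s).sub_const t₀).const_mul a).exp
    · exact (by fun_prop : Continuous fun s => a * Real.exp (a * (s - t₀))).intervalIntegrable _ _
  · have : ∫ s in t₀..t, a * Real.exp (a * |s - t₀|) = ∫ s in t₀..t, a * Real.exp (a * (t₀ - s)) := by
      refine intervalIntegral.integral_congr fun s hs => ?_
      rw [uIcc_of_ge h] at hs
      simp only [abs_of_nonpos (sub_nonpos.2 hs.2), neg_sub]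
    rw [this, intervalIntegral.integral_eq_sub_of_hasDerivAt
      (f := fun s => -Real.exp (a * (t₀ - s)))]
    · simp only [abs_of_nonpos (sub_nonpos.2 h), neg_sub, sub_self, mul_zero, Real.exp_zero,
        sub_neg_eq_add]
      rw [← abs_neg]
      congr 1
      ring
    · intro s _
      simpa [mul_comm] using (((hasDerivAt_id s).const_sub t₀).const_mul a).exp.fun_neg
    · exact (by fun_prop : Continuous fun s => a * Real.exp (a * (t₀ - s))).intervalIntegrable _ _

/-- The exponential weight reproduces itself under integration, on either side of `t₀`. It serves
both for a priori bounds, with rate `C`, and for absorbing a Lipschitz term, with rate `2 * L`. -/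
theorem norm_integral_le_of_norm_le_exp {E : Type*} [NormedAddCommGroup E] [NormedSpace ℝ E]
    {F : ℝ → E} {a B t₀ t : ℝ} (ha : 0 ≤ a) (hB : 0 ≤ B)
    (hF : ∀ s ∈ uIoc t₀ t, ‖F s‖ ≤ B * (a * Real.exp (a * |s - t₀|))) :
    ‖∫ s in t₀..t, F s‖ ≤ B * (Real.exp (a * |t - t₀|) - 1) := by
  have h := intervalIntegral.norm_integral_le_abs_of_norm_le (μ := volume)
    (g := fun s => B * (a * Real.exp (a * |s - t₀|)))
    ((ae_restrict_iff' measurableSet_uIoc).2 (Eventually.of_forall hF))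
    ((by fun_prop : Continuous fun s => B * (a * Real.exp (a * |s - t₀|))).intervalIntegrable _ _)
  rwa [intervalIntegral.integral_const_mul, abs_mul, abs_of_nonneg hB, abs_integral_exp_abs_sub,
    abs_of_nonneg (sub_nonneg.2 (Real.one_le_exp (by positivity)))] at h

/-- An integral form of Grönwall's inequality. -/
theorem le_two_mul_exp_of_le_integral {φ : ℝ → ℝ} {t₀ t₁ a L : ℝ} (hL : 0 ≤ L) (ha : 0 ≤ a)
    (hφ : ContinuousOn φ (Icc t₀ t₁)) (hφ0 : ∀ t ∈ Icc t₀ t₁, 0 ≤ φ t)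
    (hle : ∀ t ∈ Icc t₀ t₁, φ t ≤ a + ∫ s in t₀..t, L * φ s) :
    ∀ t ∈ Icc t₀ t₁, φ t ≤ 2 * a * Real.exp (2 * L * |t - t₀|) := by
  intro t ht
  -- At the maximum `m` of the weighted function, the rate `2 * L`, twice the Lipschitz rate, lets
  -- the integral contribute at most half of `m * exp`, which is absorbed on the left.
  obtain ⟨τ, hτ, hmax⟩ := isCompact_Icc.exists_isMaxOn ⟨t, ht⟩
    (hφ.mul (by fun_prop : Continuous fun s => Real.exp (-(2 * L * |s - t₀|))).continuousOn)
  set m := φ τ * Real.exp (-(2 * L * |τ - t₀|)) with hm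
  have hm0 : 0 ≤ m := mul_nonneg (hφ0 τ hτ) (Real.exp_pos _).le
  have hbd : ∀ s ∈ Icc t₀ t₁, φ s ≤ m * Real.exp (2 * L * |s - t₀|) := by
    intro s hs
    have := hmax hs
    simp only [mem_ofPred_eq] at this
    calc φ s = φ s * Real.exp (-(2 * L * |s - t₀|)) * Real.exp (2 * L * |s - t₀|) := by
          rw [mul_assoc, ← Real.exp_add]; simp
      _ ≤ _ := mul_le_mul_of_nonneg_right this (Real.exp_pos _).le
  have hint := norm_integral_le_of_norm_le_exp (F := fun s => L * φ s) (a := 2 * L) (B := m / 2)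
    (t₀ := t₀) (t := τ) (by positivity) (by positivity) (by
      intro s hs
      rw [uIoc_of_le hτ.1] at hs
      have hs' : s ∈ Icc t₀ t₁ := ⟨hs.1.le, hs.2.trans hτ.2⟩
      rw [Real.norm_of_nonneg (mul_nonneg hL (hφ0 s hs'))]
      calc L * φ s ≤ L * (m * Real.exp (2 * L * |s - t₀|)) :=
            mul_le_mul_of_nonneg_left (hbd s hs') hL
        _ = _ := by ring)
  have h1 := hle τ hτ
  have h2 := (Real.le_norm_self _).trans hint
  have h3 : φ τ = m * Real.exp (2 * L * |τ - t₀|) := by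
    rw [hm, mul_assoc, ← Real.exp_add]; simp
  have h4 : 1 ≤ Real.exp (2 * L * |τ - t₀|) := Real.one_le_exp (by positivity)
  have h5 : m ≤ 2 * a := by
    by_contra! hcon
    nlinarith
  exact (hbd t ht).trans (mul_le_mul_of_nonneg_right h5 (Real.exp_pos _).le)

/-! ### Admissible controlled fields and Carathéodory solutions -/

/-- A controlled vector field which is jointly continuous, of sublinear growth, and Lipschitz in
the phase variable on bounded sets. -/
structure IsAdmissible {E K : Type*} [NormedAddCommGroup E] [TopologicalSpace K]
    (h : ℝ → E → K → E) (C : ℝ) : Prop where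
  nonneg : 0 ≤ C
  continuous : Continuous fun p : ℝ × E × K => h p.1 p.2.1 p.2.2
  growth : ∀ t x k, ‖h t x k‖ ≤ C * (1 + ‖x‖)
  lipschitz : ∀ R : ℝ, ∃ L : ℝ, 0 ≤ L ∧ ∀ t x x', ‖x‖ ≤ R → ‖x'‖ ≤ R → ∀ k,
    ‖h t x k - h t x' k‖ ≤ L * ‖x - x'‖

namespace IsAdmissible

theorem norm_le {E K : Type*} [NormedAddCommGroup E] [TopologicalSpace K] {h : ℝ → E → K → E}
    {C : ℝ} (hh : IsAdmissible h C) {t : ℝ} {x : E} {k : K} {M : ℝ} (hx : ‖x‖ ≤ M) :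
    ‖h t x k‖ ≤ C * (1 + M) :=
  (hh.growth t x k).trans (mul_le_mul_of_nonneg_left (by linarith) hh.nonneg)

variable {E K : Type*} [NormedAddCommGroup E] [NormedSpace ℝ E] [FiniteDimensional ℝ E]
  [MeasurableSpace E] [BorelSpace E] [MetricSpace K] [CompactSpace K] [MeasurableSpace K]
  [BorelSpace K] {h : ℝ → E → K → E} {C : ℝ}

theorem measurable_comp (hh : IsAdmissible h C) {ζ : ℝ → E} {κ : ℝ → K} (hζ : Measurable ζ)
    (hκ : Measurable κ) : Measurable fun s => h s (ζ s) (κ s) :=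
  hh.continuous.measurable.comp (measurable_id.prodMk (hζ.prodMk hκ))

theorem intervalIntegrable (hh : IsAdmissible h C) {ζ : ℝ → E} {κ : ℝ → K} (hζ : Measurable ζ)
    (hκ : Measurable κ) {a b M : ℝ} (hM : ∀ s ∈ uIoc a b, ‖ζ s‖ ≤ M) :
    IntervalIntegrable (fun s => h s (ζ s) (κ s)) volume a b := by
  refine (intervalIntegrable_const (c := C * (1 + M))).mono_fun'
    (hh.measurable_comp hζ hκ).aestronglyMeasurable ?_
  exact (ae_restrict_iff' measurableSet_uIoc).2 (Eventually.of_forall fun s hs =>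
    hh.norm_le (hM s hs))

theorem intervalIntegrable_of_continuous (hh : IsAdmissible h C) {ζ : ℝ → E} {κ : ℝ → K}
    (hζ : Continuous ζ) (hκ : Measurable κ) (a b : ℝ) :
    IntervalIntegrable (fun s => h s (ζ s) (κ s)) volume a b := by
  obtain ⟨M, hM⟩ := (isCompact_uIcc (a := a) (b := b)).exists_bound_of_continuousOn hζ.continuousOn
  exact hh.intervalIntegrable hζ.measurable hκ fun s hs => hM s (uIoc_subset_uIcc hs)

/-- The Picard operator on continuous curves over `[0,T]`. -/
noncomputable def picardMap (hh : IsAdmissible h C) {T : ℝ} (hT : 0 ≤ T) {κ : ℝ → K}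
    (hκ : Measurable κ) (t₀ : ℝ) (x₀ : E) (x : C(Icc (0 : ℝ) T, E)) : C(Icc (0 : ℝ) T, E) where
  toFun t := x₀ + ∫ s in t₀..t, h s (IccExtend hT x s) (κ s)
  continuous_toFun := by
    have := intervalIntegral.continuous_primitive
      (hh.intervalIntegrable_of_continuous (x.continuous.Icc_extend' (h := hT)) hκ) t₀
    fun_prop

/-- Existence of the solution for a measurable control, with its a priori bound. -/
theorem exists_solution (hh : IsAdmissible h C) {T : ℝ} (hT : 0 ≤ T) {κ : ℝ → K}
    (hκ : Measurable κ) {t₀ : ℝ} (ht₀ : t₀ ∈ Icc 0 T) (x₀ : E) :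
    ∃ x : C(Icc (0 : ℝ) T, E),
      (∀ t : Icc (0 : ℝ) T, x t = x₀ + ∫ s in t₀..t, h s (IccExtend hT x s) (κ s)) ∧
      ∀ t, 1 + ‖x t‖ ≤ (1 + ‖x₀‖) * Real.exp (C * |(t : ℝ) - t₀|) := by
  set Φ := hh.picardMap hT hκ t₀ x₀ with hΦ
  have hsub : ∀ t : Icc (0 : ℝ) T, ∀ s ∈ uIoc t₀ t, s ∈ Icc 0 T := fun t s hs =>
    (ordConnected_Icc.uIcc_subset ht₀ t.2) (uIoc_subset_uIcc hs)
  let X : ℕ → C(Icc (0 : ℝ) T, E) := fun k => Φ^[k] (ContinuousMap.const _ x₀)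
  have hX : ∀ k, X (k + 1) = Φ (X k) := fun k => Function.iterate_succ_apply' ..
  -- The Picard operator preserves this growth bound, so all iterates stay in one ball and a single
  -- local Lipschitz constant suffices.
  have hbd : ∀ k t, 1 + ‖X k t‖ ≤ (1 + ‖x₀‖) * Real.exp (C * |(t : ℝ) - t₀|) := by
    intro k
    induction k with
    | zero =>
      intro t
      exact le_mul_of_one_le_right (by positivity)
        (Real.one_le_exp (mul_nonneg hh.nonneg (abs_nonneg _)))
    | succ k ih =>
      intro t
      rw [hX]
      have h1 := norm_integral_le_of_norm_le_exp (F := fun s => h s (IccExtend hT (X k) s) (κ s))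
        (a := C) (B := 1 + ‖x₀‖) (t₀ := t₀) (t := t) hh.nonneg (by positivity) (by
          intro s hs
          have hs' := hsub t s hs
          refine (hh.growth _ _ _).trans ?_
          have := ih ⟨s, hs'⟩
          rw [IccExtend_of_mem hT _ hs']
          calc _ ≤ C * ((1 + ‖x₀‖) * Real.exp (C * |s - t₀|)) :=
                mul_le_mul_of_nonneg_left this hh.nonneg
            _ = _ := by ring)
      have h2 : ‖Φ (X k) t‖ ≤ ‖x₀‖ + ‖∫ s in t₀..t, h s (IccExtend hT (X k) s) (κ s)‖ :=
        norm_add_le _ _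
      linarith
  set M := (1 + ‖x₀‖) * Real.exp (C * T) with hMdef
  have habs : ∀ t : Icc (0 : ℝ) T, |(t : ℝ) - t₀| ≤ T := fun t =>
    abs_sub_le_iff.2 ⟨by linarith [t.2.2, ht₀.1], by linarith [t.2.1, ht₀.2]⟩
  have hM : ∀ k t, ‖X k t‖ ≤ M := fun k t => by
    have h1 := hbd k t
    have h2 : Real.exp (C * |(t : ℝ) - t₀|) ≤ Real.exp (C * T) :=
      Real.exp_le_exp.2 (mul_le_mul_of_nonneg_left (habs t) hh.nonneg)
    have h3 := mul_le_mul_of_nonneg_left h2 (by positivity : 0 ≤ 1 + ‖x₀‖)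
    linarith
  obtain ⟨L, hL0, hL⟩ := hh.lipschitz M
  have hint : ∀ (x : C(Icc (0 : ℝ) T, E)) (a b : ℝ),
      IntervalIntegrable (fun s => h s (IccExtend hT x s) (κ s)) volume a b := fun x a b =>
    hh.intervalIntegrable_of_continuous (x.continuous.Icc_extend' (h := hT)) hκ a b
  have hdiff : ∀ (x y : C(Icc (0 : ℝ) T, E)) (t : Icc (0 : ℝ) T), Φ x t - Φ y t =
      ∫ s in t₀..t, (h s (IccExtend hT x s) (κ s) - h s (IccExtend hT y s) (κ s)) := fun x y t => by
    rw [intervalIntegral.integral_sub (hint x _ _) (hint y _ _)]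
    exact add_sub_add_left_eq_sub _ _ _
  -- In the norm weighted with rate `2 * L` the Picard operator contracts these iterates by the
  -- factor `1 / 2` on all of `[0, T]`, with no restriction to short intervals.
  have hcon : ∀ k t, ‖X (k + 1) t - X k t‖ ≤
      2 * M * (1 / 2) ^ k * Real.exp (2 * L * |(t : ℝ) - t₀|) := by
    intro k
    induction k with
    | zero =>
      intro t
      have h1 := norm_sub_le (X 1 t) (X 0 t)
      have h2 := hM 1 t
      have h3 := hM 0 t
      have h4 : 1 ≤ Real.exp (2 * L * |(t : ℝ) - t₀|) := Real.one_le_exp (by positivity)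
      have h5 : 0 ≤ M := (norm_nonneg _).trans h2
      simp only [zero_add, pow_zero, mul_one]
      nlinarith
    | succ k ih =>
      intro t
      rw [hX (k + 1), hX k, hdiff, ← hX k]
      have hM0 : 0 ≤ M := (norm_nonneg _).trans (hM 0 t)
      refine (norm_integral_le_of_norm_le_exp (a := 2 * L) (B := M * (1 / 2) ^ k)
        (by positivity) (by positivity) ?_).trans ?_
      · intro s hs
        have hs' := hsub t s hs
        rw [IccExtend_of_mem hT _ hs', IccExtend_of_mem hT _ hs']
        refine (hL _ _ _ (hM _ _) (hM _ _) _).trans ?_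
        calc _ ≤ L * (2 * M * (1 / 2) ^ k * Real.exp (2 * L * |s - t₀|)) :=
              mul_le_mul_of_nonneg_left (ih ⟨s, hs'⟩) hL0
          _ = _ := by ring
      · have : 0 ≤ M * (1 / 2) ^ k := by positivity
        rw [pow_succ]
        linarith
  have hdist : ∀ k, dist (X k) (X (k + 1)) ≤ 2 * M * Real.exp (2 * L * T) * (1 / 2) ^ k := by
    intro k
    have hM0 : 0 ≤ M := by positivity
    rw [dist_comm, ContinuousMap.dist_le (by positivity)]
    intro t
    rw [dist_eq_norm]
    refine (hcon k t).trans ?_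
    have : Real.exp (2 * L * |(t : ℝ) - t₀|) ≤ Real.exp (2 * L * T) :=
      Real.exp_le_exp.2 (mul_le_mul_of_nonneg_left (habs t) (by positivity))
    calc _ ≤ 2 * M * (1 / 2) ^ k * Real.exp (2 * L * T) := by gcongr
      _ = _ := by ring
  have hcau : CauchySeq X := cauchySeq_of_dist_le_of_summable _ hdist
    ((summable_geometric_of_lt_one (by norm_num) (by norm_num)).mul_left _)
  obtain ⟨x, hx⟩ := cauchySeq_tendsto_of_complete hcau
  have hxt : ∀ t, Tendsto (fun k => X k t) atTop (𝓝 (x t)) := fun t =>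
    ((continuous_eval_const t).tendsto x).comp hx
  have hxM : ∀ t, ‖x t‖ ≤ M := fun t => le_of_tendsto (hxt t).norm (Eventually.of_forall (hM · t))
  refine ⟨x, fun t => ?_, fun t => le_of_tendsto ((hxt t).norm.const_add 1)
    (Eventually.of_forall (hbd · t))⟩
  change x t = Φ x t
  refine tendsto_nhds_unique ((hxt t).comp (tendsto_add_atTop_nat 1)) ?_
  simp only [Function.comp_def, hX]
  rw [tendsto_iff_norm_sub_tendsto_zero]
  have hlim : Tendsto (fun k => L * dist (X k) x * |(t : ℝ) - t₀|) atTop (𝓝 0) := by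
    simpa using ((tendsto_iff_dist_tendsto_zero.1 hx).const_mul L).mul_const |(t : ℝ) - t₀|
  refine squeeze_zero (fun _ => norm_nonneg _) (fun k => ?_) hlim
  rw [hdiff]
  refine intervalIntegral.norm_integral_le_of_norm_le_const fun s hs => ?_
  have hs' := hsub t s hs
  rw [IccExtend_of_mem hT _ hs', IccExtend_of_mem hT _ hs']
  refine (hL _ _ _ (hM _ _) (hxM _) _).trans (mul_le_mul_of_nonneg_left ?_ hL0)
  rw [← dist_eq_norm]
  exact ContinuousMap.dist_apply_le_dist _

end IsAdmissible

/-! ### Approximate motions along which `c` is almost constant -/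

/-- One step of an `ε`-approximate motion along which `c` varies at a rate of at most `ε`. -/
def ApproxStep {E K W : Type*} [NormedAddCommGroup E] [NormedSpace ℝ E] [MeasurableSpace K]
    [NormedAddCommGroup W] (h : ℝ → E → K → E) (c : ℝ → E → W) (T ε : ℝ) (p q : ℝ × E) : Prop :=
  p.1 < q.1 ∧ q.1 ≤ T ∧ q.1 - p.1 ≤ ε ∧ ‖c q.1 q.2 - c p.1 p.2‖ ≤ ε * (q.1 - p.1) ∧
    ∃ κ : ℝ → K, Measurable κ ∧
      ‖q.2 - p.2 - ∫ s in p.1..q.1, h s p.2 (κ s)‖ ≤ ε * (q.1 - p.1)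

/-- From every position some velocity of the convexified field almost preserves `c`. -/
def HasAlmostInvariantDirections {E K W : Type*} [NormedAddCommGroup E] [NormedSpace ℝ E]
    [NormedAddCommGroup W] (h : ℝ → E → K → E) (c : ℝ → E → W) (T : ℝ) : Prop :=
  ∀ t ∈ Ico 0 T, ∀ x : E, ∀ ε > 0, ∃ w ∈ convexHull ℝ (range (h t x)),
    ∃ᶠ p in 𝓝[>] (0 : ℝ) ×ˢ 𝓝 w, ‖c (t + p.1) (x + p.1 • p.2) - c t x‖ ≤ ε * p.1

namespace IsAdmissible

section

variable {E K W : Type*} [NormedAddCommGroup E] [NormedSpace ℝ E] [TopologicalSpace K]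
  [MeasurableSpace K] [NormedAddCommGroup W] {h : ℝ → E → K → E} {C : ℝ} {c : ℝ → E → W} {T ε : ℝ}

/-- A discrete Grönwall step, from `1 + r ≤ exp r`; the summand `1` in `C + 1` pays for the error
rate `ε ≤ 1`. -/
theorem approxStep_norm_le (hh : IsAdmissible h C) (hε : ε ≤ 1)
    {p q : ℝ × E} (hpq : ApproxStep h c T ε p q) :
    1 + ‖q.2‖ ≤ (1 + ‖p.2‖) * Real.exp ((C + 1) * (q.1 - p.1)) := by
  obtain ⟨h1, -, -, -, κ, -, h2⟩ := hpq
  have h3 : ‖∫ s in p.1..q.1, h s p.2 (κ s)‖ ≤ C * (1 + ‖p.2‖) * |q.1 - p.1| :=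
    intervalIntegral.norm_integral_le_of_norm_le_const fun s _ => hh.growth _ _ _
  have hτ : 0 < q.1 - p.1 := sub_pos.2 h1
  rw [abs_of_pos hτ] at h3
  set I := ∫ s in p.1..q.1, h s p.2 (κ s) with hI
  have h4 : ‖q.2‖ ≤ ‖q.2 - p.2 - I‖ + ‖p.2‖ + ‖I‖ := by
    have : q.2 = (q.2 - p.2 - I) + p.2 + I := by abel
    calc ‖q.2‖ = ‖(q.2 - p.2 - I) + p.2 + I‖ := by rw [← this]
      _ ≤ _ := norm_add₃_le
  have h5 := Real.add_one_le_exp ((C + 1) * (q.1 - p.1))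
  have h6 := mul_le_mul_of_nonneg_left h5 (by positivity : 0 ≤ 1 + ‖p.2‖)
  have h7 : ε * (q.1 - p.1) ≤ 1 * (q.1 - p.1) := by gcongr
  have h8 : 0 ≤ ‖p.2‖ * (q.1 - p.1) := by positivity
  nlinarith

/-- Over a chain the increments of `c` add up and the exponential growth factors multiply. -/
theorem chain_bounds (hh : IsAdmissible h C) (hε : ε ≤ 1) {p₀ p : ℝ × E} (hp₀ : p₀.1 ≤ T)
    (hp : Relation.ReflTransGen (ApproxStep h c T ε) p₀ p) :
    p₀.1 ≤ p.1 ∧ p.1 ≤ T ∧ ‖c p.1 p.2 - c p₀.1 p₀.2‖ ≤ ε * (p.1 - p₀.1) ∧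
      1 + ‖p.2‖ ≤ (1 + ‖p₀.2‖) * Real.exp ((C + 1) * (p.1 - p₀.1)) := by
  induction hp with
  | refl => simpa using hp₀
  | @tail p q _ hpq ih =>
    obtain ⟨i1, i2, i3, i4⟩ := ih
    have hb := hh.approxStep_norm_le hε hpq
    obtain ⟨h1, h2, -, h3, -⟩ := hpq
    refine ⟨i1.trans h1.le, h2, ?_, ?_⟩
    · have := norm_add_le (c q.1 q.2 - c p.1 p.2) (c p.1 p.2 - c p₀.1 p₀.2)
      rw [sub_add_sub_cancel] at this
      linarith
    · calc _ ≤ _ := hb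
        _ ≤ (1 + ‖p₀.2‖) * Real.exp ((C + 1) * (p.1 - p₀.1)) *
            Real.exp ((C + 1) * (q.1 - p.1)) := by gcongr
        _ = _ := by rw [mul_assoc, ← Real.exp_add]; ring_nf

/-- The a priori bound for approximate motions over `[0,T]`. -/
theorem chain_norm_le (hh : IsAdmissible h C) (hε : ε ≤ 1) {p₀ p : ℝ × E} (hp₀ : p₀.1 ∈ Icc 0 T)
    (hp : Relation.ReflTransGen (ApproxStep h c T ε) p₀ p) :
    ‖p.2‖ ≤ (1 + ‖p₀.2‖) * Real.exp ((C + 1) * T) := by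
  obtain ⟨h1, h2, -, h3⟩ := hh.chain_bounds hε hp₀.2 hp
  have hC := hh.nonneg
  have : Real.exp ((C + 1) * (p.1 - p₀.1)) ≤ Real.exp ((C + 1) * T) :=
    Real.exp_le_exp.2 (mul_le_mul_of_nonneg_left (by linarith [hp₀.1]) (by linarith))
  have := mul_le_mul_of_nonneg_left this (by positivity : 0 ≤ 1 + ‖p₀.2‖)
  linarith

end

variable {E K W : Type*} [NormedAddCommGroup E] [NormedSpace ℝ E] [FiniteDimensional ℝ E]
  [MeasurableSpace E] [BorelSpace E] [MetricSpace K] [CompactSpace K] [MeasurableSpace K]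
  [BorelSpace K] [NormedAddCommGroup W] {h : ℝ → E → K → E} {C : ℝ} {c : ℝ → E → W} {T ε : ℝ}

/-- Near a given position the field varies little, uniformly in the control. -/
theorem eventually_norm_sub_le {E K : Type*} [NormedAddCommGroup E] [TopologicalSpace K]
    [CompactSpace K] {h : ℝ → E → K → E} {C : ℝ} (hh : IsAdmissible h C) (t : ℝ) (x : E) {η : ℝ}
    (hη : 0 < η) : ∀ᶠ p : ℝ × E in 𝓝 (t, x), ∀ k, ‖h p.1 p.2 k - h t x k‖ ≤ η := by
  obtain ⟨v, hv, hvu⟩ := (isCompact_univ (X := K)).mem_uniformity_of_prod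
    (f := fun (p : ℝ × E) k => h p.1 p.2 k) (s := univ) (q := (t, x))
    (hh.continuous.comp (by fun_prop : Continuous fun q : (ℝ × E) × K =>
      (q.1.1, q.1.2, q.2))).continuousOn (mem_univ _) (Metric.dist_mem_uniformity hη)
  rw [nhdsWithin_univ] at hv
  filter_upwards [hv] with p hp k
  rw [← dist_eq_norm]
  exact (hvu p hp k (mem_univ k)).le

/-- Split the integral at `p₀.1`: the first piece has vanishing length and a bounded integrand, the
second is controlled by the Lipschitz constant. Thus a step from one position can be reused from
nearby ones. -/
theorem tendsto_integral (hh : IsAdmissible h C) {κ : ℝ → K} (hκ : Measurable κ) (b : ℝ)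
    (p₀ : ℝ × E) :
    Tendsto (fun p : ℝ × E => ∫ s in p.1..b, h s p.2 (κ s)) (𝓝 p₀)
      (𝓝 (∫ s in p₀.1..b, h s p₀.2 (κ s))) := by
  have hint : ∀ (x : E) (u v : ℝ), IntervalIntegrable (fun s => h s x (κ s)) volume u v :=
    fun x => hh.intervalIntegrable_of_continuous continuous_const hκ
  set R := ‖p₀.2‖ + 1 with hR
  obtain ⟨L, hL0, hL⟩ := hh.lipschitz R
  rw [tendsto_iff_norm_sub_tendsto_zero]
  have hlim : Tendsto (fun p : ℝ × E => C * (1 + R) * |p₀.1 - p.1| +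
      L * ‖p.2 - p₀.2‖ * |b - p₀.1|) (𝓝 p₀) (𝓝 0) := by
    have : Continuous fun p : ℝ × E => C * (1 + R) * |p₀.1 - p.1| +
      L * ‖p.2 - p₀.2‖ * |b - p₀.1| := by fun_prop
    simpa using this.tendsto p₀
  have hnear : ∀ᶠ p : ℝ × E in 𝓝 p₀, ‖p.2‖ < R :=
    (continuous_snd.norm.tendsto p₀).eventually (gt_mem_nhds (by simp [hR]))
  refine squeeze_zero' (Eventually.of_forall fun _ => norm_nonneg _) ?_ hlim
  filter_upwards [hnear] with p hp
  rw [← intervalIntegral.integral_add_adjacent_intervals (hint p.2 p.1 p₀.1) (hint p.2 p₀.1 b),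
    add_sub_assoc, ← intervalIntegral.integral_sub (hint p.2 _ _) (hint p₀.2 _ _)]
  refine (norm_add_le _ _).trans (add_le_add ?_ ?_)
  · exact intervalIntegral.norm_integral_le_of_norm_le_const fun s _ => hh.norm_le hp.le
  · exact intervalIntegral.norm_integral_le_of_norm_le_const fun s _ =>
      hL _ _ _ hp.le (by simp [hR]) _

/-- From all positions that are near `(t, x)` and not later there is a common approximate step
beyond the time `t`. -/
theorem exists_approxStep (hh : IsAdmissible h C)
    (hc : ContinuousOn (fun p : ℝ × E => c p.1 p.2) (Icc 0 T ×ˢ univ))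
    (H : HasAlmostInvariantDirections h c T) (hε : 0 < ε) {t : ℝ} (ht : t ∈ Ico 0 T) (x : E) :
    ∃ q : ℝ × E, t < q.1 ∧ ∀ᶠ p in 𝓝[Icc 0 t ×ˢ univ] (t, x), ApproxStep h c T ε p q := by
  -- Asking for `ε / 2` leaves slack: the step inequalities become strict at `(t, x)` and therefore
  -- persist nearby.
  obtain ⟨w, hw, hfr⟩ := H t ht x (ε / 2) (half_pos hε)
  have hT : 0 < T - t := sub_pos.2 ht.2
  have hev1 : ∀ᶠ δ in 𝓝[>] (0 : ℝ), ∀ r ∈ Icc t (t + δ), ∀ k, ‖h r x k - h t x k‖ ≤ ε / 8 := by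
    have h1 := hh.eventually_norm_sub_le t x (η := ε / 8) (by positivity)
    obtain ⟨ρ, hρ, hball⟩ := Metric.eventually_nhds_iff.1 h1
    filter_upwards [nhdsWithin_le_nhds (gt_mem_nhds hρ)] with δ hδ r hr k
    refine hball (y := (r, x)) ?_ k
    simp only [dist_prod_same_right, Real.dist_eq]
    rw [abs_of_nonneg (sub_nonneg.2 hr.1)]
    linarith [hr.2]
  have hev2 : ∀ᶠ δ in 𝓝[>] (0 : ℝ), 0 < δ ∧ δ < ε ∧ δ < T - t ∧
      ∀ r ∈ Icc t (t + δ), ∀ k, ‖h r x k - h t x k‖ ≤ ε / 8 := by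
    filter_upwards [self_mem_nhdsWithin, nhdsWithin_le_nhds (gt_mem_nhds hε),
      nhdsWithin_le_nhds (gt_mem_nhds hT), hev1] with δ h1 h2 h3 h4
    exact ⟨h1, h2, h3, h4⟩
  have hev3 : ∀ᶠ w' in 𝓝 w, ‖w' - w‖ < ε / 8 := by
    filter_upwards [Metric.ball_mem_nhds w (by positivity : 0 < ε / 8)] with w' hw'
    rwa [← dist_eq_norm]
  have hev := hev2.prod_mk hev3
  obtain ⟨⟨δ, w'⟩, hcδ, ⟨hδ0, hδε, hδT, hhδ⟩, hw'⟩ := (hfr.and_eventually hev).exists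
  simp only at hcδ hδ0 hδε hδT hhδ hw'
  obtain ⟨κ, hκ, hκi, hκw⟩ := exists_integral_eq_of_mem_convexHull hw t (t + δ) (by linarith)
  refine ⟨(t + δ, x + δ • w'), by simpa using hδ0, ?_⟩
  have hint : ‖(x + δ • w') - x - ∫ s in t..(t + δ), h s x (κ s)‖ < ε * (t + δ - t) := by
    -- Two errors of rate `ε / 8` each: replacing `w'` by `w`, and freezing the time at `t` in the
    -- field.
    have e1 : (x + δ • w') - x - ∫ s in t..(t + δ), h s x (κ s) =
        δ • (w' - w) - ∫ s in t..(t + δ), (h s x (κ s) - h t x (κ s)) := by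
      rw [intervalIntegral.integral_sub
        (hh.intervalIntegrable_of_continuous continuous_const hκ _ _) hκi, hκw, smul_sub]
      simp only [add_sub_cancel_left]
      abel
    rw [e1]
    have e2 : ‖∫ s in t..(t + δ), (h s x (κ s) - h t x (κ s))‖ ≤ ε / 8 * |t + δ - t| := by
      refine intervalIntegral.norm_integral_le_of_norm_le_const fun s hs => ?_
      rw [uIoc_of_le (by linarith)] at hs
      exact hhδ s ⟨hs.1.le, hs.2⟩ _
    rw [add_sub_cancel_left, abs_of_pos hδ0] at e2
    have e3 : ‖δ • (w' - w)‖ ≤ δ * (ε / 8) := by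
      rw [norm_smul, Real.norm_of_nonneg hδ0.le]
      gcongr
    have := norm_sub_le (δ • (w' - w)) (∫ s in t..(t + δ), (h s x (κ s) - h t x (κ s)))
    have : 0 < ε * δ := by positivity
    rw [add_sub_cancel_left]
    linarith
  have hc' : ‖c (t + δ) (x + δ • w') - c t x‖ < ε * (t + δ - t) := by
    have : 0 < ε * δ := by positivity
    rw [add_sub_cancel_left]
    linarith
  -- The target `q` and the control stay fixed while the starting point `p` varies; every quantity
  -- in the step is continuous in `p`.
  have t1 : Tendsto (fun p : ℝ × E => ε * (t + δ - p.1)) (𝓝[Icc 0 t ×ˢ univ] (t, x))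
      (𝓝 (ε * (t + δ - t))) :=
    ((by fun_prop : Continuous fun p : ℝ × E => ε * (t + δ - p.1)).tendsto (t, x)).mono_left
      nhdsWithin_le_nhds
  have t2 : Tendsto (fun p : ℝ × E => c p.1 p.2) (𝓝[Icc 0 t ×ˢ univ] (t, x)) (𝓝 (c t x)) :=
    (hc (t, x) ⟨⟨ht.1, ht.2.le⟩, mem_univ _⟩).mono
      (prod_mono (Icc_subset_Icc_right ht.2.le) subset_rfl)
  have t3 : Tendsto (fun p : ℝ × E => (x + δ • w') - p.2 - ∫ s in p.1..(t + δ), h s p.2 (κ s))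
      (𝓝[Icc 0 t ×ˢ univ] (t, x))
      (𝓝 ((x + δ • w') - x - ∫ s in t..(t + δ), h s x (κ s))) :=
    (((continuous_const.sub continuous_snd).tendsto (t, x)).sub
      (hh.tendsto_integral hκ (t + δ) (t, x))).mono_left nhdsWithin_le_nhds
  have t4 : Tendsto (fun p : ℝ × E => t + δ - p.1) (𝓝[Icc 0 t ×ˢ univ] (t, x))
      (𝓝 (t + δ - t)) :=
    ((by fun_prop : Continuous fun p : ℝ × E => t + δ - p.1).tendsto (t, x)).mono_left
      nhdsWithin_le_nhds
  filter_upwards [self_mem_nhdsWithin, t4.eventually (gt_mem_nhds (by linarith : t + δ - t < ε)),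
    (t2.const_sub (c (t + δ) (x + δ • w'))).norm.eventually_lt t1 hc',
    t3.norm.eventually_lt t1 hint] with p hp h1 h2 h3
  exact ⟨by simpa using hp.1.2.trans_lt (by linarith), by simpa using (by linarith : t + δ ≤ T),
    h1.le, h2.le, κ, hκ, h3.le⟩

/-- Approximate motions get arbitrarily close to the terminal time. -/
theorem exists_chain (hh : IsAdmissible h C)
    (hc : ContinuousOn (fun p : ℝ × E => c p.1 p.2) (Icc 0 T ×ˢ univ))
    (H : HasAlmostInvariantDirections h c T) (hε0 : 0 < ε) (hε : ε ≤ 1) {p₀ : ℝ × E}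
    (hp₀ : p₀.1 ∈ Icc 0 T) :
    ∃ p, Relation.ReflTransGen (ApproxStep h c T ε) p₀ p ∧ T - ε < p.1 := by
  by_contra! hcon
  -- If the reachable times stayed below `T - ε`, chain ends with times tending to their supremum
  -- `τ` would be bounded and so cluster at some `(τ, a.2)`. No chain need reach that limit, but the
  -- step valid from all nearby earlier positions leads beyond `τ`.
  set S : Set ℝ := Prod.fst '' {p | Relation.ReflTransGen (ApproxStep h c T ε) p₀ p} with hS
  have hne : S.Nonempty := ⟨p₀.1, p₀, Relation.ReflTransGen.refl, rfl⟩
  have hub : T - ε ∈ upperBounds S := by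
    rintro _ ⟨p, hp, rfl⟩
    exact hcon p hp
  have hlub := isLUB_csSup hne ⟨_, hub⟩
  set τ := sSup S with hτ
  have hτT : τ < T := by linarith [hlub.2 hub]
  have hτ0 : 0 ≤ τ := hp₀.1.trans (hlub.1 ⟨p₀, Relation.ReflTransGen.refl, rfl⟩)
  obtain ⟨u, -, -, hu, huS⟩ := hlub.exists_seq_monotone_tendsto hne
  choose p hp hpu using huS
  set M := (1 + ‖p₀.2‖) * Real.exp ((C + 1) * T)
  have hmem : ∀ k, p k ∈ Icc 0 τ ×ˢ Metric.closedBall (0 : E) M := fun k =>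
    ⟨⟨hp₀.1.trans (hh.chain_bounds hε hp₀.2 (hp k)).1, hlub.1 ⟨p k, hp k, rfl⟩⟩,
      mem_closedBall_zero_iff.2 (hh.chain_norm_le hε hp₀ (hp k))⟩
  obtain ⟨a, -, φ, hφ, hlim⟩ :=
    (isCompact_Icc.prod (isCompact_closedBall (0 : E) M)).tendsto_subseq hmem
  have ha : a.1 = τ := by
    refine tendsto_nhds_unique ((continuous_fst.tendsto a).comp hlim) ?_
    have : (Prod.fst ∘ p ∘ φ) = u ∘ φ := funext fun k => hpu _
    rw [this]
    exact hu.comp hφ.tendsto_atTop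
  obtain ⟨q, hq, hev⟩ := hh.exists_approxStep hc H hε0 (t := τ) ⟨hτ0, hτT⟩ a.2
  have hlim' : Tendsto (p ∘ φ) atTop (𝓝[Icc 0 τ ×ˢ univ] (τ, a.2)) := by
    refine tendsto_nhdsWithin_iff.2 ⟨?_, Eventually.of_forall fun k => ⟨(hmem _).1, mem_univ _⟩⟩
    rwa [← ha]
  obtain ⟨k, hk⟩ := (hlim'.eventually hev).exists
  exact absurd (hlub.1 ⟨q, (hp _).tail hk, rfl⟩) (not_le.2 hq)

/-- The control and the step function carried by an approximate motion. -/
theorem exists_control_of_chain (hh : IsAdmissible h C) (hε0 : 0 < ε) (hε : ε ≤ 1) {p₀ p : ℝ × E}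
    (hp₀ : p₀.1 ∈ Icc 0 T) (hp : Relation.ReflTransGen (ApproxStep h c T ε) p₀ p) [Nonempty K]
    {M : ℝ} (hM : M = (1 + ‖p₀.2‖) * Real.exp ((C + 1) * T)) :
    ∃ (κ : ℝ → K) (ζ : ℝ → E), Measurable κ ∧ Measurable ζ ∧ (∀ s, ‖ζ s‖ ≤ M) ∧
      (∀ s ∈ Ico p₀.1 p.1,
        (∃ σ ∈ Icc p₀.1 s, s - σ ≤ ε ∧ ‖c σ (ζ s) - c p₀.1 p₀.2‖ ≤ ε * T) ∧
        ‖ζ s - p₀.2 - ∫ r in p₀.1..s, h r (ζ r) (κ r)‖ ≤ ε * (T + C * (1 + M))) ∧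
      ‖p.2 - p₀.2 - ∫ r in p₀.1..p.1, h r (ζ r) (κ r)‖ ≤ ε * (p.1 - p₀.1) := by
  induction hp with
  | refl =>
    refine ⟨fun _ => Classical.arbitrary K, fun _ => p₀.2, measurable_const, measurable_const,
      fun s => ?_, by simp, by simp⟩
    rw [hM]
    exact hh.chain_norm_le (c := c) hε hp₀ .refl
  | @tail p q hp hpq ih =>
    obtain ⟨κ, ζ, hκ, hζ, hζM, ih1, ih2⟩ := ih
    have hpM := hh.chain_norm_le hε hp₀ hp
    rw [← hM] at hpM
    obtain ⟨hp1, hp2, hp3, -⟩ := hh.chain_bounds hε hp₀.2 hp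
    obtain ⟨h1, h2, h3, -, κ', hκ', h5⟩ := hpq
    -- `ζ` keeps the position of the last node until the next one; the new step appends its own
    -- control and the constant `p.2` from time `p.1` on.
    set κ₁ := (Iio p.1).piecewise κ κ' with hκ₁
    set ζ₁ := (Iio p.1).piecewise ζ fun _ => p.2 with hζ₁
    have mκ : Measurable κ₁ := hκ.piecewise measurableSet_Iio hκ'
    have mζ : Measurable ζ₁ := hζ.piecewise measurableSet_Iio measurable_const
    have bζ : ∀ s, ‖ζ₁ s‖ ≤ M := fun s => by
      by_cases hs : s < p.1
      · simpa [hζ₁, hs] using hζM s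
      · simpa [hζ₁, hs] using hpM
    have hint : ∀ a b, IntervalIntegrable (fun r => h r (ζ₁ r) (κ₁ r)) volume a b := fun a b =>
      hh.intervalIntegrable mζ mκ fun s _ => bζ s
    have e1 : ∀ s, p₀.1 ≤ s → s ≤ p.1 → ∫ r in p₀.1..s, h r (ζ₁ r) (κ₁ r) =
        ∫ r in p₀.1..s, h r (ζ r) (κ r) := by
      intro s hs hsp
      rw [intervalIntegral.integral_of_le hs, intervalIntegral.integral_of_le hs,
        -- The switch takes place at `p.1` itself, which may equal `s`, so the right endpoint is
        -- discarded as a null set.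
        integral_Ioc_eq_integral_Ioo, integral_Ioc_eq_integral_Ioo]
      refine setIntegral_congr_fun measurableSet_Ioo fun r hr => ?_
      have : r < p.1 := hr.2.trans_le hsp
      simp [hζ₁, hκ₁, this]
    have e2 : ∀ s, p.1 ≤ s → ∫ r in p.1..s, h r (ζ₁ r) (κ₁ r) =
        ∫ r in p.1..s, h r p.2 (κ' r) := by
      intro s hs
      refine intervalIntegral.integral_congr fun r hr => ?_
      rw [uIcc_of_le hs] at hr
      simp [hζ₁, hκ₁, not_lt.2 hr.1]
    have e3 : ∀ s, p.1 ≤ s → ∫ r in p₀.1..s, h r (ζ₁ r) (κ₁ r) =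
        (∫ r in p₀.1..p.1, h r (ζ r) (κ r)) + ∫ r in p.1..s, h r p.2 (κ' r) := by
      intro s hs
      rw [← intervalIntegral.integral_add_adjacent_intervals (hint p₀.1 p.1) (hint p.1 s),
        e1 _ hp1 le_rfl, e2 s hs]
    refine ⟨κ₁, ζ₁, mκ, mζ, bζ, ?_, ?_⟩
    · intro s hs
      rcases lt_or_ge s p.1 with hsp | hsp
      · rw [e1 s hs.1 hsp.le]
        simpa [hζ₁, hsp] using ih1 s ⟨hs.1, hsp⟩
      · have hζs : ζ₁ s = p.2 := by simp [hζ₁, not_lt.2 hsp]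
        rw [hζs, e3 s hsp]
        refine ⟨⟨p.1, ⟨hp1, hsp⟩, by linarith [hs.2], hp3.trans ?_⟩, ?_⟩
        · exact mul_le_mul_of_nonneg_left (by linarith [hp₀.1]) hε0.le
        -- Between nodes the integral moves with speed at most `C * (1 + M)` for a time at most `ε`;
        -- this is the second part of the error constant.
        · have i1 : ‖∫ r in p.1..s, h r p.2 (κ' r)‖ ≤ C * (1 + M) * |s - p.1| :=
            intervalIntegral.norm_integral_le_of_norm_le_const fun r _ => hh.norm_le hpM
          rw [abs_of_nonneg (sub_nonneg.2 hsp)] at i1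
          have i2 : C * (1 + M) * (s - p.1) ≤ C * (1 + M) * ε :=
            mul_le_mul_of_nonneg_left (by linarith [hs.2])
              (mul_nonneg hh.nonneg (by linarith [norm_nonneg p.2]))
          have i3 : ε * (p.1 - p₀.1) ≤ ε * T :=
            mul_le_mul_of_nonneg_left (by linarith [hp₀.1]) hε0.le
          have i4 := norm_sub_le (p.2 - p₀.2 - ∫ r in p₀.1..p.1, h r (ζ r) (κ r))
            (∫ r in p.1..s, h r p.2 (κ' r))
          rw [← sub_sub]
          linarith
    · rw [e3 q.1 h1.le]
      have := norm_add_le (p.2 - p₀.2 - ∫ r in p₀.1..p.1, h r (ζ r) (κ r))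
        (q.2 - p.2 - ∫ r in p.1..q.1, h r p.2 (κ' r))
      have e : (p.2 - p₀.2 - ∫ r in p₀.1..p.1, h r (ζ r) (κ r)) +
        (q.2 - p.2 - ∫ r in p.1..q.1, h r p.2 (κ' r)) =
          q.2 - p₀.2 - ((∫ r in p₀.1..p.1, h r (ζ r) (κ r)) + ∫ r in p.1..q.1, h r p.2 (κ' r)) := by
        abel
      rw [e] at this
      linarith

end IsAdmissible

/-! ### Compactness, stability and the passage to the limit -/

/-- Uniformly bounded and uniformly Lipschitz curves over `[0,T]` have a uniform cluster point. -/
theorem exists_subseq_tendsto_of_lipschitz {E : Type*} [NormedAddCommGroup E] [ProperSpace E]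
    {T M B : ℝ} (x : ℕ → C(Icc (0 : ℝ) T, E)) (hM : ∀ k t, ‖x k t‖ ≤ M)
    (hB : ∀ k s t, ‖x k s - x k t‖ ≤ B * dist s t) :
    ∃ (y : C(Icc (0 : ℝ) T, E)) (φ : ℕ → ℕ), StrictMono φ ∧ Tendsto (x ∘ φ) atTop (𝓝 y) := by
  let e := ContinuousMap.isometryEquivBoundedOfCompact (Icc (0 : ℝ) T) E
  let A : Set (BoundedContinuousFunction (Icc (0 : ℝ) T) E) := range fun k => e (x k)
  have hA : IsCompact (closure A) := by
    refine BoundedContinuousFunction.arzela_ascoli (Metric.closedBall 0 M)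
      (isCompact_closedBall 0 M) A ?_ ?_
    · rintro _ t ⟨k, rfl⟩
      exact mem_closedBall_zero_iff.2 (hM k t)
    · refine Metric.equicontinuous_of_continuity_modulus (fun d => B * d) ?_ _ ?_
      · exact Continuous.tendsto' (by fun_prop) _ _ (by simp)
      · rintro s t ⟨_, k, rfl⟩
        rw [dist_eq_norm]
        exact hB k s t
  obtain ⟨z, -, φ, hφ, hlim⟩ := hA.tendsto_subseq
    (x := fun k => e (x k)) fun k => subset_closure ⟨k, rfl⟩
  refine ⟨e.symm z, φ, hφ, ?_⟩
  have := (e.symm.continuous.tendsto z).comp hlim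
  simpa [Function.comp_def] using this

/-- The curves over `[0,T]` through `(t₀,x₀)` generated by measurable controls. -/
def controlledCurves {E K : Type*} [NormedAddCommGroup E] [NormedSpace ℝ E] [MeasurableSpace K]
    (h : ℝ → E → K → E) {T : ℝ} (hT : 0 ≤ T) (t₀ : ℝ) (x₀ : E) : Set C(Icc (0 : ℝ) T, E) :=
  {x | ∃ κ : ℝ → K, Measurable κ ∧
    ∀ t : Icc (0 : ℝ) T, x t = x₀ + ∫ s in t₀..t, h s (IccExtend hT x s) (κ s)}

namespace IsAdmissible

variable {E K W : Type*} [NormedAddCommGroup E] [NormedSpace ℝ E] [FiniteDimensional ℝ E]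
  [MeasurableSpace E] [BorelSpace E] [MetricSpace K] [CompactSpace K] [MeasurableSpace K]
  [BorelSpace K] [NormedAddCommGroup W] {h : ℝ → E → K → E} {C : ℝ} {c : ℝ → E → W} {T : ℝ}

/-- Stability: the solution stays close to a curve satisfying the integral equation up to `b`. -/
theorem norm_sub_le_of_approx (hh : IsAdmissible h C) (hT : 0 ≤ T) {κ : ℝ → K} (hκ : Measurable κ)
    {ζ : ℝ → E} (hζ : Measurable ζ) {M L b : ℝ} (hL0 : 0 ≤ L)
    (hL : ∀ t x x', ‖x‖ ≤ M → ‖x'‖ ≤ M → ∀ k, ‖h t x k - h t x' k‖ ≤ L * ‖x - x'‖)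
    (hζM : ∀ s, ‖ζ s‖ ≤ M) {t₀ t₁ : ℝ} (ht₀ : 0 ≤ t₀) (ht₁ : t₁ ∈ Icc t₀ T) {x₀ : E}
    {x : C(Icc (0 : ℝ) T, E)}
    (hx : ∀ t : Icc (0 : ℝ) T, x t = x₀ + ∫ s in t₀..t, h s (IccExtend hT x s) (κ s))
    (hxM : ∀ t, ‖x t‖ ≤ M) (hb : 0 ≤ b)
    (happ : ∀ s ∈ Icc t₀ t₁, ‖ζ s - x₀ - ∫ r in t₀..s, h r (ζ r) (κ r)‖ ≤ b) :
    ‖IccExtend hT x t₁ - ζ t₁‖ ≤ (1 + 2 * (L * T) * Real.exp (2 * L * T)) * b := by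
  have hsub : ∀ s ∈ Icc t₀ t₁, s ∈ Icc 0 T := fun s hs => ⟨ht₀.trans hs.1, hs.2.trans ht₁.2⟩
  have hxc : Continuous (IccExtend hT x) := x.continuous.Icc_extend'
  have i1 : ∀ u v, IntervalIntegrable (fun s => h s (IccExtend hT x s) (κ s)) volume u v :=
    hh.intervalIntegrable_of_continuous hxc hκ
  have i2 : ∀ u v, IntervalIntegrable (fun s => h s (ζ s) (κ s)) volume u v := fun u v =>
    hh.intervalIntegrable hζ hκ fun s _ => hζM s
  -- `ζ` is only a measurable step function, so Grönwall is applied to the continuous curve `z`,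
  -- which stays within `b` of it.
  let z : ℝ → E := fun s => x₀ + ∫ r in t₀..s, h r (ζ r) (κ r)
  have hz : Continuous z := continuous_const.add (intervalIntegral.continuous_primitive i2 t₀)
  have hζz : ∀ s ∈ Icc t₀ t₁, ‖z s - ζ s‖ ≤ b := fun s hs => by
    rw [norm_sub_rev, ← sub_sub]
    exact happ s hs
  have hφc : Continuous fun s => ‖IccExtend hT x s - z s‖ := (hxc.sub hz).norm
  have hφ := le_two_mul_exp_of_le_integral (φ := fun s => ‖IccExtend hT x s - z s‖)
    (t₀ := t₀) (t₁ := t₁) (a := L * T * b) hL0 (by positivity) hφc.continuousOn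
    (fun _ _ => norm_nonneg _) (by
      intro s hs
      have e : IccExtend hT x s - z s = ∫ r in t₀..s,
          (h r (IccExtend hT x r) (κ r) - h r (ζ r) (κ r)) := by
        rw [intervalIntegral.integral_sub (i1 _ _) (i2 _ _), IccExtend_of_mem hT _ (hsub s hs), hx]
        exact add_sub_add_left_eq_sub _ _ _
      have i3 : IntervalIntegrable (fun r => L * ‖IccExtend hT x r - z r‖) volume t₀ s :=
        (hφc.const_mul L).intervalIntegrable _ _
      calc ‖IccExtend hT x s - z s‖
          ≤ ∫ r in t₀..s, (L * b + L * ‖IccExtend hT x r - z r‖) := by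
            rw [e]
            refine intervalIntegral.norm_integral_le_of_norm_le hs.1
              (Eventually.of_forall fun r hr => ?_) (intervalIntegrable_const.add i3)
            have hr' : r ∈ Icc t₀ t₁ := ⟨hr.1.le, hr.2.trans hs.2⟩
            have hxr : ‖IccExtend hT x r‖ ≤ M := hxM _
            refine (hL _ _ _ hxr (hζM r) _).trans ?_
            have := norm_sub_le_norm_sub_add_norm_sub (IccExtend hT x r) (z r) (ζ r)
            have := hζz r hr'
            rw [← mul_add]
            exact mul_le_mul_of_nonneg_left (by linarith) hL0
        _ = (s - t₀) * (L * b) + ∫ r in t₀..s, L * ‖IccExtend hT x r - z r‖ := by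
            rw [intervalIntegral.integral_add intervalIntegrable_const i3,
              intervalIntegral.integral_const, smul_eq_mul]
        _ ≤ _ := by
            have : (s - t₀) * (L * b) ≤ T * (L * b) :=
              mul_le_mul_of_nonneg_right (by linarith [(hsub s hs).2]) (by positivity)
            linarith)
  have hτ : t₁ ∈ Icc t₀ t₁ := ⟨ht₁.1, le_rfl⟩
  have h1 := hφ t₁ hτ
  have h2 := norm_sub_le_norm_sub_add_norm_sub (IccExtend hT x t₁) (z t₁) (ζ t₁)
  have h3 := hζz t₁ hτ
  have h4 : Real.exp (2 * L * |t₁ - t₀|) ≤ Real.exp (2 * L * T) := by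
    rw [abs_of_nonneg (sub_nonneg.2 ht₁.1)]
    exact Real.exp_le_exp.2 (mul_le_mul_of_nonneg_left (by linarith [ht₁.2]) (by positivity))
  have h5 := mul_le_mul_of_nonneg_left h4 (by positivity : 0 ≤ 2 * (L * T * b))
  linarith

/-- If almost invariant directions exist everywhere, then from every position starts a limit of
controlled curves along which `c` is constant. -/
theorem exists_invariant_motion [Nonempty K] (hh : IsAdmissible h C) (hT : 0 ≤ T)
    (hc : ContinuousOn (fun p : ℝ × E => c p.1 p.2) (Icc 0 T ×ˢ univ))
    (H : HasAlmostInvariantDirections h c T) {t₀ : ℝ} (ht₀ : t₀ ∈ Icc 0 T) (x₀ : E) :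
    ∃ y ∈ closure (controlledCurves h hT t₀ x₀), ∀ t : Icc (0 : ℝ) T, t₀ ≤ t →
      c t (y t) = c t₀ x₀ := by
  set M := (1 + ‖x₀‖) * Real.exp ((C + 1) * T) with hM
  have hM0 : 0 ≤ M := by positivity
  have hC := hh.nonneg
  obtain ⟨L, hL0, hL⟩ := hh.lipschitz M
  let ε : ℕ → ℝ := fun m => 1 / ((m : ℝ) + 1)
  have hε0 : ∀ m, 0 < ε m := fun m => by positivity
  have hε1 : ∀ m, ε m ≤ 1 := fun m => by
    rw [div_le_one (by positivity)]
    linarith [(Nat.cast_nonneg m : (0 : ℝ) ≤ m)]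
  have hεlim : Tendsto ε atTop (𝓝 0) := tendsto_one_div_add_atTop_nhds_zero_nat
  have hchain := fun m => hh.exists_chain hc H (hε0 m) (hε1 m) (p₀ := (t₀, x₀)) ht₀
  choose p hp hpT using hchain
  choose κ ζ hκ hζ hζM hmid hend using fun m =>
    hh.exists_control_of_chain (hε0 m) (hε1 m) (p₀ := (t₀, x₀)) ht₀ (hp m) hM
  -- The control of each chain now drives a genuine solution; these solutions, not the step
  -- functions, are equicontinuous and converge.
  choose x hx hxb using fun m => hh.exists_solution hT (hκ m) ht₀ x₀
  have hxM : ∀ m t, ‖x m t‖ ≤ M := fun m t => by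
    have h1 : Real.exp (C * |(t : ℝ) - t₀|) ≤ Real.exp ((C + 1) * T) := by
      refine Real.exp_le_exp.2 (mul_le_mul (by linarith) ?_ (abs_nonneg _) (by linarith))
      exact abs_sub_le_iff.2 ⟨by linarith [t.2.2, ht₀.1], by linarith [t.2.1, ht₀.2]⟩
    have h2 := mul_le_mul_of_nonneg_left h1 (by positivity : 0 ≤ 1 + ‖x₀‖)
    linarith [hxb m t]
  have hxLip : ∀ m s t, ‖x m s - x m t‖ ≤ C * (1 + M) * dist s t := fun m s t => by
    have hi := hh.intervalIntegrable_of_continuous ((x m).continuous.Icc_extend' (h := hT)) (hκ m)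
    rw [hx, hx, add_sub_add_left_eq_sub, intervalIntegral.integral_interval_sub_left (hi _ _)
      (hi _ _)]
    exact intervalIntegral.norm_integral_le_of_norm_le_const fun r _ => hh.norm_le (hxM m _)
  obtain ⟨y, φ, hφ, hlim⟩ := exists_subseq_tendsto_of_lipschitz x hxM hxLip
  refine ⟨y, mem_closure_of_tendsto hlim (Eventually.of_forall fun k => ⟨κ _, hκ _, hx _⟩), ?_⟩
  have hyt : ∀ t, Tendsto (fun k => x (φ k) t) atTop (𝓝 (y t)) := fun t =>
    ((continuous_eval_const t).tendsto y).comp hlim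
  have hεφ : Tendsto (fun k => ε (φ k)) atTop (𝓝 0) := hεlim.comp hφ.tendsto_atTop
  have hyt₀ : y ⟨t₀, ht₀⟩ = x₀ := by
    refine tendsto_nhds_unique (hyt _) ?_
    simp only [hx, intervalIntegral.integral_same, add_zero]
    exact tendsto_const_nhds
  -- Chains are only known to pass `T - ε`, so times before `T` come first; the terminal time
  -- follows by continuity.
  have hlt : ∀ t : Icc (0 : ℝ) T, t₀ ≤ t → (t : ℝ) < T → c t (y t) = c t₀ x₀ := by
    intro t ht htT
    have key : ∀ η > 0, ‖c t (y t) - c t₀ x₀‖ ≤ η := by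
      intro η hη
      obtain ⟨δ, hδ, hcδ⟩ := Metric.continuousWithinAt_iff.1 (hc (t, y t) ⟨t.2, mem_univ _⟩) (η / 2)
        (half_pos hη)
      set A := (1 + 2 * (L * T) * Real.exp (2 * L * T)) * (T + C * (1 + M)) with hA
      have l1 : Tendsto (fun k => A * ε (φ k) + ‖x (φ k) t - y t‖) atTop (𝓝 0) := by
        simpa using (hεφ.const_mul A).add (tendsto_iff_norm_sub_tendsto_zero.1 (hyt t))
      have l2 : Tendsto (fun k => ε (φ k) * T) atTop (𝓝 0) := by simpa using hεφ.mul_const T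
      obtain ⟨k, k1, k2, k3, k4⟩ := ((l1.eventually (gt_mem_nhds hδ)).and
        ((l2.eventually (gt_mem_nhds (half_pos hη))).and ((hεφ.eventually (gt_mem_nhds hδ)).and
          (hεφ.eventually (gt_mem_nhds (sub_pos.2 htT)))))).exists
      set m := φ k
      have htp : (t : ℝ) < (p m).1 := by linarith [hpT m]
      obtain ⟨⟨σ, hσ, hσt, hσc⟩, -⟩ := hmid m t ⟨ht, htp⟩
      have hclose := hh.norm_sub_le_of_approx hT (hκ m) (hζ m) hL0 hL (hζM m) ht₀.1
        (t₁ := t) ⟨ht, t.2.2⟩ (hx m) (hxM m) (b := ε m * (T + C * (1 + M)))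
        (by have := (hε0 m).le; positivity)
        fun s hs => (hmid m s ⟨hs.1, hs.2.trans_lt htp⟩).2
      rw [IccExtend_val] at hclose
      have hd : dist (σ, ζ m t) ((t : ℝ), y t) < δ := by
        rw [Prod.dist_eq, max_lt_iff]
        constructor
        · rw [Real.dist_eq, abs_sub_comm, abs_of_nonneg (sub_nonneg.2 hσ.2)]
          exact hσt.trans_lt k3
        · rw [dist_eq_norm]
          have := norm_sub_le_norm_sub_add_norm_sub (ζ m t) (x m t) (y t)
          rw [norm_sub_rev (ζ m t) (x m t)] at this
          have e : (1 + 2 * (L * T) * Real.exp (2 * L * T)) * (ε m * (T + C * (1 + M))) =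
            A * ε m := by rw [hA]; ring
          linarith
      have h1 := hcδ (x := (σ, ζ m t)) ⟨⟨ht₀.1.trans hσ.1, hσ.2.trans t.2.2⟩, mem_univ _⟩ hd
      rw [dist_eq_norm, norm_sub_rev] at h1
      have h2 := norm_sub_le_norm_sub_add_norm_sub (c t (y t)) (c σ (ζ m t)) (c t₀ x₀)
      simp only at h1 hσc
      linarith
    exact sub_eq_zero.1 (norm_le_zero_iff.1 (le_of_forall_pos_le_add fun η hη => by
      simpa using key η hη))
  intro t ht
  -- The initial time is treated apart: if `t₀ = T`, there are no earlier times from which to pass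
  -- to the limit.
  rcases ht.eq_or_lt with heq | hlt₀
  · have : t = ⟨t₀, ht₀⟩ := Subtype.ext heq.symm
    rw [this, hyt₀]
  rcases t.2.2.lt_or_eq with hlt' | hTeq
  · exact hlt t ht hlt'
  have hcont : ContinuousOn (fun s : ℝ => c s (IccExtend hT y s)) (Icc 0 T) :=
    hc.comp (continuous_id.prodMk (y.continuous.Icc_extend' (h := hT))).continuousOn
      fun s hs => ⟨hs, mem_univ _⟩
  have hcw : Tendsto (fun s : ℝ => c s (IccExtend hT y s)) (𝓝[Ioo t₀ t] t) (𝓝 (c t (y t))) := by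
    have := (hcont t t.2).mono fun s (hs : s ∈ Ioo t₀ t) =>
      ⟨ht₀.1.trans hs.1.le, hs.2.le.trans t.2.2⟩
    rwa [ContinuousWithinAt, IccExtend_val] at this
  have : (𝓝[Ioo t₀ (t : ℝ)] (t : ℝ)).NeBot := right_nhdsWithin_Ioo_neBot hlt₀
  refine tendsto_nhds_unique (hcw.congr' ?_) tendsto_const_nhds
  filter_upwards [self_mem_nhdsWithin] with s hs
  have hs' : s ∈ Icc 0 T := ⟨ht₀.1.trans hs.1.le, hs.2.le.trans t.2.2⟩
  rw [IccExtend_of_mem hT _ hs']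
  exact hlt ⟨s, hs'⟩ hs.1.le (hs.2.trans_eq hTeq)

/-! ### Initial velocities of motions -/

/-- The difference quotients of a limit of controlled curves accumulate at a velocity of the
convexified field. -/
theorem exists_velocity_mapClusterPt [Nonempty K] (hh : IsAdmissible h C) (hT : 0 ≤ T) {t : ℝ}
    (ht : t ∈ Ico 0 T) {x : E} {y : C(Icc (0 : ℝ) T, E)}
    (hy : y ∈ closure (controlledCurves h hT t x)) :
    ∃ w ∈ convexHull ℝ (range (h t x)),
      MapClusterPt w (𝓝[>] 0) fun δ : ℝ => δ⁻¹ • (IccExtend hT y (t + δ) - x) := by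
  set F := convexHull ℝ (range (h t x)) with hF
  have hFc : IsCompact F := isCompact_convexHull (isCompact_range
    (hh.continuous.comp (by fun_prop : Continuous fun k : K => (t, x, k))))
  have hTt : 0 < T - t := sub_pos.2 ht.2
  have key : ∀ η > 0, ∀ᶠ δ in 𝓝[>] (0 : ℝ),
      δ⁻¹ • (IccExtend hT y (t + δ) - x) ∈ Metric.cthickening η F := by
    intro η hη
    set M := ‖y‖ + 1 with hM
    have hM0 : 0 ≤ M := by positivity
    set B := C * (1 + M) with hB
    have hB0 : 0 ≤ B := mul_nonneg hh.nonneg (by linarith)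
    obtain ⟨ρ, hρ, hball⟩ := Metric.eventually_nhds_iff.1 (hh.eventually_norm_sub_le t x hη)
    have hρB : 0 < ρ / (1 + B) := by positivity
    filter_upwards [self_mem_nhdsWithin, nhdsWithin_le_nhds (gt_mem_nhds hTt),
      nhdsWithin_le_nhds (gt_mem_nhds hρB)] with δ hδ0 hδT hδρ
    have hδ0 : 0 < δ := hδ0
    rw [lt_div_iff₀ (by positivity)] at hδρ
    have hmem : ∀ s ∈ Icc t (t + δ), s ∈ Icc 0 T := fun s hs =>
      ⟨ht.1.trans hs.1, by linarith [hs.2]⟩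
    have hcl : IsClosed {z : C(Icc (0 : ℝ) T, E) |
        δ⁻¹ • (IccExtend hT z (t + δ) - x) ∈ Metric.cthickening η F} := by
      refine Metric.isClosed_cthickening.preimage (.const_smul (.sub ?_ continuous_const) _)
      exact continuous_eval_const _
    -- The property is closed under uniform limits, so controlled curves suffice. Those in the unit
    -- ball around `y` share the bound `M`, which makes the threshold on `δ` independent of the
    -- curve.
    have hy' : y ∈ closure (controlledCurves h hT t x ∩ Metric.ball y 1) := by
      rw [inter_comm]
      exact Metric.isOpen_ball.inter_closure ⟨Metric.mem_ball_self one_pos, hy⟩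
    refine closure_minimal ?_ hcl hy'
    rintro z ⟨⟨κ, hκ, hz⟩, hzy⟩
    have hzM : ∀ s, ‖z s‖ ≤ M := fun s => by
      have h1 : ‖z - y‖ < 1 := by rwa [← dist_eq_norm]
      have h2 := z.norm_coe_le_norm s
      have h3 := norm_sub_norm_le z y
      linarith
    have hint := hh.intervalIntegrable_of_continuous (z.continuous.Icc_extend' (h := hT)) hκ
    have hzx : ∀ s ∈ Icc t (t + δ), ‖IccExtend hT z s - x‖ ≤ B * δ := fun s hs => by
      rw [IccExtend_of_mem hT _ (hmem s hs), hz, add_sub_cancel_left]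
      refine (intervalIntegral.norm_integral_le_of_norm_le_const fun r _ =>
        hh.norm_le (hzM _)).trans (mul_le_mul_of_nonneg_left ?_ hB0)
      simp only
      rw [abs_of_nonneg (sub_nonneg.2 hs.1)]
      linarith [hs.2]
    have hval : ∀ s ∈ Ioc t (t + δ), h s (IccExtend hT z s) (κ s) ∈ Metric.cthickening η F := by
      intro s hs
      have hs' : s ∈ Icc t (t + δ) := ⟨hs.1.le, hs.2⟩
      refine Metric.mem_cthickening_of_dist_le _ (h t x (κ s)) _ _
        (subset_convexHull ℝ _ ⟨κ s, rfl⟩) ?_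
      rw [dist_eq_norm]
      refine hball (y := (s, IccExtend hT z s)) ?_ (κ s)
      rw [Prod.dist_eq, max_lt_iff, Real.dist_eq, dist_eq_norm, abs_of_nonneg (sub_nonneg.2 hs'.1)]
      have := hzx s hs'
      have : 0 ≤ B * δ := by positivity
      constructor
      · linarith [hs.2]
      · linarith
    -- The difference quotient is the mean velocity over `(t, t + δ]`, and a closed convex set
    -- contains the mean of values lying in it.
    have hav := ((convex_convexHull ℝ (range (h t x))).cthickening η).set_average_mem
      Metric.isClosed_cthickening (μ := volume) (t := Ioc t (t + δ))
      (f := fun s => h s (IccExtend hT z s) (κ s)) (by simp [hδ0]) (by simp)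
      ((ae_restrict_iff' measurableSet_Ioc).2 (Eventually.of_forall hval))
      ((intervalIntegrable_iff_integrableOn_Ioc_of_le (by linarith)).1 (hint t (t + δ)))
    rw [setAverage_eq, ← intervalIntegral.integral_of_le (by linarith)] at hav
    have hδm : t + δ ∈ Icc 0 T := hmem _ ⟨by linarith, le_rfl⟩
    change δ⁻¹ • (IccExtend hT z (t + δ) - x) ∈ Metric.cthickening η F
    rw [IccExtend_of_mem hT _ hδm, hz, add_sub_cancel_left]
    simpa [measureReal_def, hδ0.le] using hav
  -- Compactness of one thickening yields a cluster point; it then lies in every thickening, hence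
  -- in the closed set `F`.
  obtain ⟨w, -, hw⟩ := (hFc.cthickening (r := 1)).exists_mapClusterPt (f := 𝓝[>] (0 : ℝ))
    (u := fun δ : ℝ => δ⁻¹ • (IccExtend hT y (t + δ) - x))
    (le_principal_iff.2 (mem_map.2 (key 1 one_pos)))
  refine ⟨w, ?_, hw⟩
  have hwη : ∀ η > 0, w ∈ Metric.cthickening η F := fun η hη =>
    Metric.isClosed_cthickening.mem_of_mapClusterPt hw (key η hη)
  have : w ∈ closure F := by
    rw [Metric.closure_eq_iInter_cthickening]
    exact mem_iInter₂.2 hwη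
  rwa [hFc.isClosed.closure_eq] at this

end IsAdmissible

/-! ### The game as a single controlled field -/

/-- The two players' dynamics as a single controlled field, extended constantly in time beyond
`[0,T]`. -/
noncomputable def combinedField {n : ℕ} {P Q : Type*} {T : ℝ} (hT : 0 ≤ T) (f : ℝ → Phase n → P → Phase n)
    (g : ℝ → Phase n → Q → Phase n) (t : ℝ) (x : Phase n) (k : P × Q) : Phase n :=
  f (projIcc 0 T hT t) x k.1 + g (projIcc 0 T hT t) x k.2

section

variable {n : ℕ} {P Q : Type*} {T : ℝ} (hT : 0 ≤ T) {f : ℝ → Phase n → P → Phase n}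
  {g : ℝ → Phase n → Q → Phase n}

theorem combinedField_of_mem {t : ℝ} (ht : t ∈ Icc 0 T) (x : Phase n) (k : P × Q) :
    combinedField hT f g t x k = f t x k.1 + g t x k.2 := by
  rw [combinedField, projIcc_of_mem hT ht]

theorem velocitySet_eq_convexHull_range {t : ℝ} (ht : t ∈ Icc 0 T) (x : Phase n) :
    velocitySet f g t x = convexHull ℝ (range (combinedField hT f g t x)) := by
  rw [velocitySet]
  congr 1
  ext w
  simp [combinedField_of_mem hT ht, eq_comm]

theorem exists_isAdmissible_combinedField [TopologicalSpace P] [TopologicalSpace Q]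
    (hf : ContinuousDynamics T f) (hg : ContinuousDynamics T g)
    (hfL : LipschitzInPhase T f) (hgL : LipschitzInPhase T g)
    (hfG : SublinearGrowth T f) (hgG : SublinearGrowth T g) :
    ∃ C, IsAdmissible (combinedField hT f g) C := by
  obtain ⟨C₁, h₁⟩ := hfG
  obtain ⟨C₂, h₂⟩ := hgG
  refine ⟨|C₁| + |C₂|, by positivity, ?_, fun t x k => ?_, fun R => ?_⟩
  · refine Continuous.add ?_ ?_
    · exact hf.comp_continuous (f := fun p : ℝ × Phase n × (P × Q) =>
        ((projIcc 0 T hT p.1 : ℝ), p.2.1, p.2.2.1)) (by fun_prop)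
        fun p => ⟨(projIcc 0 T hT p.1).2, mem_univ _⟩
    · exact hg.comp_continuous (f := fun p : ℝ × Phase n × (P × Q) =>
        ((projIcc 0 T hT p.1 : ℝ), p.2.1, p.2.2.2)) (by fun_prop)
        fun p => ⟨(projIcc 0 T hT p.1).2, mem_univ _⟩
  · rw [add_mul]
    refine (norm_add_le _ _).trans (add_le_add ?_ ?_)
    · exact (h₁ _ (projIcc 0 T hT t).2 x k.1).trans
        (mul_le_mul_of_nonneg_right (le_abs_self _) (by positivity))
    · exact (h₂ _ (projIcc 0 T hT t).2 x k.2).trans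
        (mul_le_mul_of_nonneg_right (le_abs_self _) (by positivity))
  · obtain ⟨L₁, l₁⟩ := hfL R
    obtain ⟨L₂, l₂⟩ := hgL R
    refine ⟨|L₁| + |L₂|, by positivity, fun t x x' hx hx' k => ?_⟩
    rw [add_mul, combinedField, combinedField, add_sub_add_comm]
    refine (norm_add_le _ _).trans (add_le_add ?_ ?_)
    · exact (l₁ _ (projIcc 0 T hT t).2 x x' hx hx' k.1).trans
        (mul_le_mul_of_nonneg_right (le_abs_self _) (norm_nonneg _))
    · exact (l₂ _ (projIcc 0 T hT t).2 x x' hx hx' k.2).trans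
        (mul_le_mul_of_nonneg_right (le_abs_self _) (norm_nonneg _))

end

section

variable {n : ℕ} {P Q : Type*} [MetricSpace P] [CompactSpace P] [MeasurableSpace P] [BorelSpace P]
  [MetricSpace Q] [CompactSpace Q] [MeasurableSpace Q] [BorelSpace Q] {T : ℝ} (hT : 0 ≤ T)
  {f : ℝ → Phase n → P → Phase n} {g : ℝ → Phase n → Q → Phase n}

/-- The motions of the game are the limits of the curves controlled by the combined field. -/
theorem sol_eq_closure_controlledCurves {C : ℝ} (hh : IsAdmissible (combinedField hT f g) C)
    {t₀ : ℝ} (ht₀ : t₀ ∈ Icc 0 T) (x₀ : Phase n) :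
    Sol T f g t₀ x₀ = closure (controlledCurves (combinedField hT f g) hT t₀ x₀) := by
  rw [Sol]
  congr 1
  ext y
  constructor
  · rintro ⟨u, v, hu, hv, x, ⟨-, -, hx⟩, hyx⟩
    refine ⟨fun s => (u s, v s), hu.prodMk hv, fun t => ?_⟩
    rw [hyx, hx t t.2]
    congr 1
    refine intervalIntegral.integral_congr fun s hs => ?_
    have hs' : s ∈ Icc 0 T := ordConnected_Icc.uIcc_subset ht₀ t.2 hs
    simp only [combinedField_of_mem hT hs', IccExtend_of_mem hT _ hs', hyx]
  · rintro ⟨κ, hκ, hy⟩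
    have heq : ∀ s ∈ Icc 0 T, combinedField hT f g s (IccExtend hT y s) (κ s) =
        f s (IccExtend hT y s) (κ s).1 + g s (IccExtend hT y s) (κ s).2 := fun s hs =>
      combinedField_of_mem hT hs _ _
    have hyc : Continuous (IccExtend hT y) := y.continuous.Icc_extend'
    refine ⟨fun s => (κ s).1, fun s => (κ s).2, hκ.fst, hκ.snd, IccExtend hT y,
      ⟨hyc.continuousOn, ?_, fun t ht => ?_⟩, fun s => (IccExtend_val hT y s).symm⟩
    · refine (hh.intervalIntegrable_of_continuous hyc hκ 0 T).congr fun s hs => ?_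
      rw [uIoc_of_le hT] at hs
      exact heq s (Ioc_subset_Icc_self hs)
    · rw [IccExtend_of_mem hT _ ht, hy]
      congr 1
      exact intervalIntegral.integral_congr fun s hs =>
        heq s (ordConnected_Icc.uIcc_subset ht₀ ht hs)

end

/-! ### The modulus derivative -/

theorem modulusDeriv_eq_zero_of_mapClusterPt {n : ℕ} {c₁ c₂ : ℝ → Phase n → ℝ} {t : ℝ}
    {x w : Phase n} {y : ℝ → Phase n}
    (hw : MapClusterPt w (𝓝[>] 0) fun δ : ℝ => δ⁻¹ • (y (t + δ) - x))
    (hy : ∀ᶠ δ in 𝓝[>] (0 : ℝ), c₁ (t + δ) (y (t + δ)) = c₁ t x ∧ c₂ (t + δ) (y (t + δ)) = c₂ t x) :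
    modulusDeriv c₁ c₂ t x w = 0 := by
  refine le_antisymm (liminf_le_of_frequently_le' fun hcon => ?_) zero_le
  obtain ⟨A, hA, B, hB, hAB⟩ := eventually_prod_iff.1 hcon
  obtain ⟨δ, hδB, hδA, hδ, h1, h2⟩ := ((hw.frequently hB).and_eventually
    (hA.and ((eventually_mem_nhdsWithin : ∀ᶠ δ in 𝓝[>] (0 : ℝ), δ ∈ Ioi 0).and hy))).exists
  refine hAB hδA hδB ?_
  -- Taking the difference quotient itself as `w'` puts `x + δ • w'` on the curve, where the
  -- numerator is zero.
  have e : x + δ • δ⁻¹ • (y (t + δ) - x) = y (t + δ) := by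
    rw [smul_inv_smul₀ (ne_of_gt hδ)]
    abel
  simp [e, h1, h2]

/-- The infimum is not claimed to be attained: `w` may depend on `ε`, which is all that the
approximate steps require. The sum of moduli dominates the sup norm on `ℝ × ℝ`, so the pair can be
treated as one function. -/
theorem exists_frequently_of_iInf_modulusDeriv_eq_zero {n : ℕ} {c₁ c₂ : ℝ → Phase n → ℝ} {t : ℝ}
    {x : Phase n} {F : Set (Phase n)} (h : ⨅ w ∈ F, modulusDeriv c₁ c₂ t x w = 0) {ε : ℝ}
    (hε : 0 < ε) : ∃ w ∈ F, ∃ᶠ p in 𝓝[>] (0 : ℝ) ×ˢ 𝓝 w,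
      ‖((c₁ (t + p.1) (x + p.1 • p.2), c₂ (t + p.1) (x + p.1 • p.2)) : ℝ × ℝ) -
        (c₁ t x, c₂ t x)‖ ≤ ε * p.1 := by
  have hlt : ⨅ w ∈ F, modulusDeriv c₁ c₂ t x w < ENNReal.ofReal ε := by
    rw [h]
    exact ENNReal.ofReal_pos.2 hε
  obtain ⟨w, hw⟩ := iInf_lt_iff.1 hlt
  obtain ⟨hwF, hw⟩ := iInf_lt_iff.1 hw
  have hpos : ∀ᶠ p in 𝓝[>] (0 : ℝ) ×ˢ 𝓝 w, p.1 ∈ Ioi (0 : ℝ) :=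
    eventually_mem_nhdsWithin.prod_inl _
  refine ⟨w, hwF, ((frequently_lt_of_liminf_lt (by isBoundedDefault) hw).and_eventually
    hpos).mono ?_⟩
  rintro ⟨δ, w'⟩ ⟨h1, hδ⟩
  have h2 := (ENNReal.ofReal_lt_ofReal_iff hε).1 h1
  rw [div_lt_iff₀ hδ] at h2
  rw [Prod.norm_def, max_le_iff]
  simp only [Prod.fst_sub, Prod.snd_sub, Real.norm_eq_abs] at h2 ⊢
  constructor
  · exact (le_add_of_nonneg_right (abs_nonneg _)).trans h2.le
  · exact (le_add_of_nonneg_left (abs_nonneg _)).trans h2.le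

end DiffGame

theorem mainTheorem8 (n : ℕ) {P Q : Type*}
    [MetricSpace P] [CompactSpace P] [Nonempty P] [MeasurableSpace P] [BorelSpace P]
    [MetricSpace Q] [CompactSpace Q] [Nonempty Q] [MeasurableSpace Q] [BorelSpace Q]
    (T : ℝ) (hT : 0 < T)
    (f : ℝ → DiffGame.Phase n → P → DiffGame.Phase n)
    (g : ℝ → DiffGame.Phase n → Q → DiffGame.Phase n)
    (hf : DiffGame.ContinuousDynamics T f) (hg : DiffGame.ContinuousDynamics T g)
    (hfL : DiffGame.LipschitzInPhase T f) (hgL : DiffGame.LipschitzInPhase T g)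
    (hfG : DiffGame.SublinearGrowth T f) (hgG : DiffGame.SublinearGrowth T g)
    (c₁ c₂ : ℝ → DiffGame.Phase n → ℝ)
    (hc₁ : ContinuousOn (fun p : ℝ × DiffGame.Phase n => c₁ p.1 p.2) (Set.Icc 0 T ×ˢ Set.univ))
    (hc₂ : ContinuousOn (fun p : ℝ × DiffGame.Phase n => c₂ p.1 p.2) (Set.Icc 0 T ×ˢ Set.univ)) :
    DiffGame.ConditionF4 T f g c₁ c₂ ↔
      ∀ t ∈ Set.Ico 0 T, ∀ x : DiffGame.Phase n,
        (⨅ w ∈ DiffGame.velocitySet f g t x, DiffGame.modulusDeriv c₁ c₂ t x w) = 0 := by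
  obtain ⟨C, hh⟩ :=
    DiffGame.exists_isAdmissible_combinedField hT.le hf hg hfL hgL hfG hgG
  constructor
  · intro hF4 t ht x
    have ht' : t ∈ Icc 0 T := Ico_subset_Icc_self ht
    obtain ⟨y, hy, hcy⟩ := hF4 t ht' x
    rw [DiffGame.sol_eq_closure_controlledCurves hT.le hh ht'] at hy
    obtain ⟨w, hw, hcl⟩ := hh.exists_velocity_mapClusterPt hT.le ht hy
    rw [← DiffGame.velocitySet_eq_convexHull_range hT.le ht'] at hw
    refine le_antisymm ((iInf₂_le w hw).trans
      (DiffGame.modulusDeriv_eq_zero_of_mapClusterPt hcl ?_).le) zero_le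
    filter_upwards [self_mem_nhdsWithin, nhdsWithin_le_nhds (gt_mem_nhds (sub_pos.2 ht.2))]
      with δ hδ hδT
    have hδ0 : 0 < δ := hδ
    have hm : t + δ ∈ Icc 0 T := ⟨by linarith [ht.1], by linarith⟩
    rw [IccExtend_of_mem hT.le _ hm]
    exact hcy ⟨t + δ, hm⟩ (by simpa using hδ0.le)
  · intro H t₀ ht₀ x₀
    have hH : DiffGame.HasAlmostInvariantDirections (DiffGame.combinedField hT.le f g)
        (fun t x => (c₁ t x, c₂ t x)) T := by
      intro t ht x ε hε
      have h0 := H t ht x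
      rw [DiffGame.velocitySet_eq_convexHull_range hT.le (Ico_subset_Icc_self ht)] at h0
      exact DiffGame.exists_frequently_of_iInf_modulusDeriv_eq_zero h0 hε
    obtain ⟨y, hy, hcy⟩ := hh.exists_invariant_motion hT.le (hc₁.prodMk hc₂) hH ht₀ x₀
    rw [← DiffGame.sol_eq_closure_controlledCurves hT.le hh ht₀] at hy
    exact ⟨y, hy, fun t ht => Prod.mk.inj (hcy t ht)⟩
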